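/- Let $\Lambda=(\lambda_n)_{n\in\mathbb N}$ be a lacunary sequence, i.e. $\lambda_n>0$ for all $n$ and there is $r>1$ with $\lambda_{n+1}\ge r\lambda_n$ for all $n$. Let $M_\Lambda^1$ be the closed linear span of the monomials $t^{\lambda_n}$, $n\in\mathbb N$, in the complex space $L^1([0,1],m)$, where $m$ is Lebesgue measure. Let $\mu$ be a finite positive measure on $[0,1)$. Call $\mu$ a Carleson measure for $M_\Lambda^1$ if there is a constant $C$ with $\|f\|_{L^1(\mu)}\le C\|f\|_{L^1(m)}$ for every finite sum $f(t)=\sum_n a_nt^{\lambda_n}$ with complex coefficients; in this case let $i_\mu^1:M_\Lambda^1\to L^1(\mu)$, $f\mapsto f$, be the bounded operator that extends the identity on such sums by continuity. Then the following are equivalent: (i) $\mu$ satisfies $(b_1)$, that is, $\displaystyle\lim_{n\to\infty}\lambda_n\int_{[0,1)}t^{\lambda_n}\,d\mu(t)=0$; (ii) $\mu$ is a Carleson measure for $M_\Lambda^1$ and $i_\mu^1$ is compact; (iii) $\mu$ is a Carleson measure for $M_\Lambda^1$ and $i_\mu^1$ is weakly compact (the image of the closed unit ball is relatively compact in the weak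 topology of $L^1(\mu)$). -/

import Mathlib

open MeasureTheory Filter Topology unitInterval
open scoped NNReal ENNReal

noncomputable section

/-- A sequence `u` of positive numbers is lacunary if there is `r > 1` with
`u (n + 1) ≥ r * u n` for every `n`. -/
def IsLacunary (u : ℕ → ℝ≥0) : Prop :=
  (∀ n, 0 < u n) ∧ ∃ r : ℝ≥0, 1 < r ∧ ∀ n, r * u n ≤ u (n + 1)

/-- The monomial `t ↦ t ^ a` (`a ≥ 0` real) as a continuous complex function on `[0,1]`. -/
def muntzMonomial (a : ℝ≥0) : C(I, ℂ) where
  toFun t := (((t : ℝ) ^ (a : ℝ) : ℝ) : ℂ)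
  continuous_toFun := Complex.continuous_ofReal.comp
    ((Real.continuous_rpow_const a.2).comp continuous_subtype_val)

/-- The Müntz polynomial `t ↦ ∑ n, b n * t ^ (Λ n)` attached to a finitely supported complex
sequence `b`, depending linearly on `b`. -/
def muntzPolynomial (Λ : ℕ → ℝ≥0) : (ℕ →₀ ℂ) →ₗ[ℂ] C(I, ℂ) :=
  Finsupp.linearCombination ℂ (fun n => muntzMonomial (Λ n))

theorem muntzPolynomial_apply (Λ : ℕ → ℝ≥0) (b : ℕ →₀ ℂ) (t : I) :
    muntzPolynomial Λ b t = b.sum fun n c => c * (((t : ℝ) ^ (Λ n : ℝ) : ℝ) : ℂ) := by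
  simp [muntzPolynomial, Finsupp.linearCombination_apply, Finsupp.sum, muntzMonomial]

/-- The Müntz polynomial with coefficients `b`, as an element of `L¹(ν)`, for a finite measure
`ν` on `[0,1]`. -/
def muntzPolynomialL1 (Λ : ℕ → ℝ≥0) (ν : Measure I) [IsFiniteMeasure ν] :
    (ℕ →₀ ℂ) →ₗ[ℂ] Lp ℂ 1 ν :=
  (ContinuousMap.toLp 1 ν ℂ : C(I, ℂ) →L[ℂ] Lp ℂ 1 ν).toLinearMap ∘ₗ muntzPolynomial Λ

/-- The Müntz space `M_Λ¹`: the closed linear span of the monomials `t ^ (Λ n)` in the space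
`L¹([0,1])` of Lebesgue measure. -/
def MuntzSpace (Λ : ℕ → ℝ≥0) : Submodule ℂ (Lp ℂ 1 (volume : Measure I)) :=
  (Submodule.span ℂ (Set.range fun n =>
    (ContinuousMap.toLp 1 volume ℂ (muntzMonomial (Λ n)) : Lp ℂ 1 (volume : Measure I)))
  ).topologicalClosure

theorem range_muntzPolynomialL1 (Λ : ℕ → ℝ≥0) (ν : Measure I) [IsFiniteMeasure ν] :
    LinearMap.range (muntzPolynomialL1 Λ ν) =
      Submodule.span ℂ (Set.range fun n =>
        (ContinuousMap.toLp 1 ν ℂ (muntzMonomial (Λ n)) : Lp ℂ 1 ν)) := by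
  rw [muntzPolynomialL1, LinearMap.range_comp, muntzPolynomial, Finsupp.range_linearCombination,
    Submodule.map_span, ← Set.range_comp]
  rfl

/-- The Müntz polynomials, as elements of the Müntz space. -/
def muntzPolynomialInSpace (Λ : ℕ → ℝ≥0) : (ℕ →₀ ℂ) →ₗ[ℂ] MuntzSpace Λ :=
  (muntzPolynomialL1 Λ volume).codRestrict (MuntzSpace Λ) fun b =>
    Submodule.le_topologicalClosure _
      (range_muntzPolynomialL1 Λ volume ▸ LinearMap.mem_range_self _ b)

theorem denseRange_muntzPolynomialInSpace (Λ : ℕ → ℝ≥0) :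
    DenseRange (muntzPolynomialInSpace Λ) := by
  rw [DenseRange, Subtype.dense_iff]
  intro x hx
  have h : x ∈ closure (LinearMap.range (muntzPolynomialL1 Λ volume) : Set _) := by
    rw [range_muntzPolynomialL1]; exact hx
  refine closure_mono ?_ h
  rintro _ ⟨b, rfl⟩
  exact ⟨_, ⟨b, rfl⟩, rfl⟩

/-- `μ` is a Carleson measure for `M_Λ¹`: there is a constant `C` such that
`‖f‖_{L¹(μ)} ≤ C * ‖f‖_{L¹([0,1])}` for every Müntz polynomial `f`. -/
def IsCarlesonMeasure (Λ : ℕ → ℝ≥0) (μ : Measure I) [IsFiniteMeasure μ] : Prop :=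
  ∃ C : ℝ, ∀ b : ℕ →₀ ℂ,
    ‖muntzPolynomialL1 Λ μ b‖ ≤ C * ‖muntzPolynomialL1 Λ (volume : Measure I) b‖

/-- The Carleson embedding `i_μ¹ : M_Λ¹ → L¹(μ)`, `f ↦ f`, of a Carleson measure `μ`: the unique
bounded operator that sends every Müntz polynomial to itself. -/
def carlesonEmbedding (Λ : ℕ → ℝ≥0) (μ : Measure I) [IsFiniteMeasure μ]
    (_h : IsCarlesonMeasure Λ μ) : MuntzSpace Λ →L[ℂ] Lp ℂ 1 μ :=
  (muntzPolynomialL1 Λ μ).extendOfNorm (muntzPolynomialInSpace Λ)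

theorem carlesonEmbedding_polynomial (Λ : ℕ → ℝ≥0) (μ : Measure I) [IsFiniteMeasure μ]
    (h : IsCarlesonMeasure Λ μ) (b : ℕ →₀ ℂ) :
    carlesonEmbedding Λ μ h (muntzPolynomialInSpace Λ b) = muntzPolynomialL1 Λ μ b :=
  LinearMap.extendOfNorm_eq (denseRange_muntzPolynomialInSpace Λ) h b

theorem carlesonEmbedding_unique (Λ : ℕ → ℝ≥0) (μ : Measure I) [IsFiniteMeasure μ]
    (h : IsCarlesonMeasure Λ μ) (T : MuntzSpace Λ →L[ℂ] Lp ℂ 1 μ)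
    (hT : ∀ b, T (muntzPolynomialInSpace Λ b) = muntzPolynomialL1 Λ μ b) :
    carlesonEmbedding Λ μ h = T :=
  LinearMap.extendOfNorm_unique (denseRange_muntzPolynomialInSpace Λ) h.choose h.choose_spec T
    (LinearMap.ext hT)

/-- A bounded operator between complex normed spaces is weakly compact if the image of the closed
unit ball is relatively compact for the weak topology. -/
def IsWeaklyCompactOperator {E F : Type*} [NormedAddCommGroup E] [NormedSpace ℂ E]
    [NormedAddCommGroup F] [NormedSpace ℂ F] (T : E →L[ℂ] F) : Prop :=
  IsCompact (closure (toWeakSpace ℂ F '' (T '' Metric.closedBall 0 1)))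

/-- Condition `(b₁)`: `λ_n * ∫_{[0,1)} t ^ λ_n dμ → 0`. -/
def SatisfiesLittleB1 (Λ : ℕ → ℝ≥0) (μ : Measure I) : Prop :=
  Tendsto (fun n => (Λ n : ℝ) * ∫ t in Set.Ico (0 : I) 1, (t : ℝ) ^ (Λ n : ℝ) ∂μ) atTop (𝓝 0)

end

/-! The key fact is that for lacunary `Λ` the normalized monomials `(λ_n + 1) t ^ λ_n` behave in
`L¹(m)` like the unit vectors of `ℓ¹` (`IsLacunary.exists_sum_norm_le`). It is proved by duality: a
Müntz polynomial is tested against a bounded function `Φ`, a sum of kernels with phases matched to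
the coefficients. With `m_n = λ_n + 1`, the resulting matrix is `(m_i m_j / (m_i + m_j)²) ^ (p +
1)`; lacunarity bounds the base away from its diagonal value `1/4`, so a large `p` makes it
diagonally dominant, and lacunarity also bounds `Φ` uniformly.

Given this, (b₁) says that the normalized monomials tend to `0` in `L¹(μ)`, and the unit ball is
sent into the closed convex hull of scalar multiples of this null sequence, a compact set.

Conversely, the functions `λ_n t ^ λ_n` lie in the unit ball and tend to `0` uniformly on each `[0,
q]`, `q < 1`. A weak cluster point of their images therefore has integral `0`, which is impossible
if their integrals stay above some `δ > 0` for infinitely many `n`. -/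

/-! ### Bump sums along lacunary sequences -/

/-- Dominates the bump by an increment of the bounded increasing function `x / (1 + x)`, so that
sums along a lacunary sequence telescope. -/
theorem div_one_add_sq_le {r x y : ℝ} (hr : 1 < r) (hx : 0 < x) (hy : r * x ≤ y) :
    x / (1 + x) ^ 2 ≤ r / (r - 1) * (y / (1 + y) - x / (1 + x)) := by
  have hxy : x ≤ y := by nlinarith
  have hy0 : 0 < y := by linarith
  have hr' : 0 < r - 1 := by linarith
  have e : r / (r - 1) * (y / (1 + y) - x / (1 + x)) =
      r * (y - x) / ((r - 1) * (1 + y) * (1 + x)) := by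
    field_simp
    ring
  rw [e, div_le_div_iff₀ (by positivity) (by positivity)]
  have key : (r - 1) * x * (1 + y) ≤ r * (y - x) * (1 + x) := by
    nlinarith [mul_nonneg hx.le (sub_nonneg.2 hy), mul_nonneg hr'.le (sub_nonneg.2 hy),
      mul_pos (mul_pos hr' hr') hx]
  calc x * ((r - 1) * (1 + y) * (1 + x)) = (r - 1) * x * (1 + y) * (1 + x) := by ring
    _ ≤ r * (y - x) * (1 + x) * (1 + x) := by gcongr
    _ = _ := by ring

/-- Along a lacunary sequence the bump `x / (1 + x) ^ 2` has uniformly bounded sums. -/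
theorem sum_div_one_add_sq_le {r : ℝ} (hr : 1 < r) {x : ℕ → ℝ} (hx : ∀ n, 0 < x n)
    (h : ∀ n, r * x n ≤ x (n + 1)) (s : Finset ℕ) :
    ∑ n ∈ s, x n / (1 + x n) ^ 2 ≤ r / (r - 1) := by
  obtain ⟨M, hM⟩ := s.exists_nat_subset_range
  have hr' : 0 < r - 1 := by linarith
  calc ∑ n ∈ s, x n / (1 + x n) ^ 2 ≤ ∑ n ∈ Finset.range M, x n / (1 + x n) ^ 2 :=
        Finset.sum_le_sum_of_subset_of_nonneg hM fun n _ _ => by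
          have := hx n
          positivity
    _ ≤ ∑ n ∈ Finset.range M,
          r / (r - 1) * (x (n + 1) / (1 + x (n + 1)) - x n / (1 + x n)) :=
        Finset.sum_le_sum fun n _ => div_one_add_sq_le hr (hx n) (h n)
    _ = r / (r - 1) * (x M / (1 + x M) - x 0 / (1 + x 0)) := by
        rw [← Finset.mul_sum, Finset.sum_range_sub (fun n => x n / (1 + x n))]
    _ ≤ r / (r - 1) * 1 := by
        have h0 := hx 0
        have h1 := hx M
        have : x M / (1 + x M) ≤ 1 := by rw [div_le_one (by positivity)]; linarith
        have : 0 ≤ x 0 / (1 + x 0) := by positivity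
        gcongr
        linarith
    _ = _ := mul_one _

/-! ### Test kernels and their moments -/

theorem integral_Ioo_eq_integral_exp_neg (f : ℝ → ℝ) :
    ∫ t in Set.Ioo (0 : ℝ) 1, f t = ∫ s in Set.Ioi (0 : ℝ), Real.exp (-s) * f (Real.exp (-s)) := by
  have him : (fun s : ℝ => Real.exp (-s)) '' Set.Ioi 0 = Set.Ioo 0 1 := by
    ext t
    constructor
    · rintro ⟨s, hs, rfl⟩
      exact ⟨Real.exp_pos _, by simpa using hs⟩
    · rintro ⟨h0, h1⟩
      exact ⟨-Real.log t, by simpa using Real.log_neg h0 h1, by simp [Real.exp_log h0]⟩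
  rw [← him, integral_image_eq_integral_abs_deriv_smul measurableSet_Ioi
    (f' := fun s => -Real.exp (-s))]
  · simp
  · intro s _
    simpa using ((hasDerivAt_neg s).exp).hasDerivWithinAt
  · intro a _ b _ hab
    simpa using hab

theorem integral_neg_log_pow_mul_rpow (k : ℕ) {c : ℝ} (hc : 0 ≤ c) :
    ∫ t : I, (-Real.log t) ^ k * (t : ℝ) ^ c = k.factorial / (c + 1) ^ (k + 1) := by
  have h1 : ∫ t : I, (-Real.log t) ^ k * (t : ℝ) ^ c =
      ∫ t in Set.Icc (0 : ℝ) 1, (-Real.log t) ^ k * t ^ c :=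
    integral_subtype_comap measurableSet_Icc (fun t : ℝ => (-Real.log t) ^ k * t ^ c)
  rw [h1, integral_Icc_eq_integral_Ioo, integral_Ioo_eq_integral_exp_neg]
  have h2 := Real.integral_rpow_mul_exp_neg_mul_Ioi (a := k + 1) (r := c + 1)
    (by positivity) (by positivity)
  rw [Real.Gamma_nat_eq_factorial] at h2
  rw [show (k.factorial : ℝ) / (c + 1) ^ (k + 1) =
    (1 / (c + 1)) ^ ((k : ℝ) + 1) * k.factorial by
      rw [← Nat.cast_succ, Real.rpow_natCast, one_div, inv_pow]
      field_simp, ← h2]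
  refine setIntegral_congr_fun measurableSet_Ioi fun s hs => ?_
  simp only [Real.log_exp, neg_neg, add_sub_cancel_right, Real.rpow_natCast]
  rw [← Real.exp_mul, mul_left_comm, ← Real.exp_add]
  ring_nf

theorem exists_pow_mul_exp_neg_le (k : ℕ) :
    ∃ C : ℝ, 0 ≤ C ∧ ∀ x : ℝ, 0 ≤ x → x ^ (k + 1) * Real.exp (-x) ≤ C * (x / (1 + x) ^ 2) := by
  refine ⟨k.factorial + 2 * (k + 1).factorial + (k + 2).factorial, by positivity, fun x hx => ?_⟩
  have h (j : ℕ) : x ^ j * Real.exp (-x) ≤ j.factorial := by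
    have := Real.pow_div_factorial_le_exp x hx j
    rw [div_le_iff₀ (by positivity)] at this
    rw [Real.exp_neg, ← div_eq_mul_inv, div_le_iff₀ (Real.exp_pos x)]
    linarith
  have h' : x ^ k * Real.exp (-x) * (1 + x) ^ 2 ≤
      k.factorial + 2 * (k + 1).factorial + (k + 2).factorial := by
    calc _ = x ^ k * Real.exp (-x) + 2 * (x ^ (k + 1) * Real.exp (-x)) +
          x ^ (k + 2) * Real.exp (-x) := by ring
      _ ≤ _ := by linarith [h k, h (k + 1), h (k + 2)]
  rw [← mul_div_assoc, le_div_iff₀ (by positivity)]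
  calc _ = x ^ k * Real.exp (-x) * (1 + x) ^ 2 * x := by ring
    _ ≤ _ := by gcongr

/-- A bounded test function on `[0,1]` whose moments against monomials are
`a ^ (p + 1) * (c + 1) ^ p / (c + 1 + a) ^ (2 * p + 2)`. -/
noncomputable def muntzKernel (p : ℕ) (a : ℝ) (t : I) : ℝ :=
  ∑ j ∈ Finset.range (p + 1), (-1) ^ j * (p.choose j : ℝ) / (p + 1 + j).factorial *
    ((a * -Real.log t) ^ (p + j + 1) * (t : ℝ) ^ a)

/-- With `x = a * -log t`, each term of the kernel is a multiple of `x ^ (p + j + 1) * exp (-x)`: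
the positive power gives decay at `0`, the exponential at infinity. -/
theorem exists_abs_muntzKernel_le (p : ℕ) :
    ∃ C : ℝ, 0 ≤ C ∧ ∀ a : ℝ, 0 < a → ∀ t : I, |muntzKernel p a t| ≤
      C * (a * -Real.log t / (1 + a * -Real.log t) ^ 2) := by
  choose C hC0 hC using exists_pow_mul_exp_neg_le
  refine ⟨∑ j ∈ Finset.range (p + 1),
    |(-1) ^ j * (p.choose j : ℝ) / (p + 1 + j).factorial| * C (p + j), by
      have := fun j => hC0 (p + j)
      exact Finset.sum_nonneg fun j _ => mul_nonneg (abs_nonneg _) (this j), fun a ha t => ?_⟩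
  have hlog : 0 ≤ -Real.log t := neg_nonneg.2 (Real.log_nonpos t.2.1 t.2.2)
  have hx : 0 ≤ a * -Real.log t := by positivity
  rw [muntzKernel, Finset.sum_mul]
  refine (Finset.abs_sum_le_sum_abs _ _).trans (Finset.sum_le_sum fun j _ => ?_)
  rw [abs_mul, mul_assoc]
  gcongr
  rw [abs_of_nonneg (mul_nonneg (pow_nonneg hx _) (Real.rpow_nonneg t.2.1 _))]
  -- At `t = 0` the convention `Real.log 0 = 0` makes both sides vanish.
  rcases t.2.1.eq_or_lt with h0 | h0
  · simp [← h0]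
  · rw [show (t : ℝ) ^ a = Real.exp (-(a * -Real.log t)) by
      rw [Real.rpow_def_of_pos h0]; ring_nf]
    exact hC (p + j) _ hx

/-- The kernel's coefficients come from expanding `(c + 1) ^ p = ((c + 1 + a) - a) ^ p` and
realizing each power of `1 / (c + 1 + a)` as a Gamma integral. -/
theorem integral_rpow_mul_muntzKernel (p : ℕ) {a c : ℝ} (ha : 0 < a) (hc : 0 ≤ c) :
    ∫ t : I, (t : ℝ) ^ c * muntzKernel p a t =
      a ^ (p + 1) * (c + 1) ^ p / (c + 1 + a) ^ (2 * p + 2) := by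
  have e : ∀ t : I, (t : ℝ) ^ c * muntzKernel p a t =
      ∑ j ∈ Finset.range (p + 1), (-1) ^ j * (p.choose j : ℝ) / (p + 1 + j).factorial *
        a ^ (p + j + 1) * ((-Real.log t) ^ (p + j + 1) * (t : ℝ) ^ (c + a)) := by
    intro t
    rw [muntzKernel, Finset.mul_sum]
    refine Finset.sum_congr rfl fun j _ => ?_
    rw [Real.rpow_add_of_nonneg t.2.1 hc ha.le]
    ring
  have hval (k : ℕ) := integral_neg_log_pow_mul_rpow k (add_nonneg hc ha.le)
  have hne : c + 1 + a ≠ 0 := by positivity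
  simp_rw [e]
  rw [integral_finsetSum]
  · simp_rw [integral_const_mul, hval]
    have hpow : (c + 1) ^ p = (-a + (c + 1 + a)) ^ p := by ring
    rw [hpow, add_pow, Finset.mul_sum, Finset.sum_div]
    refine Finset.sum_congr rfl fun j hj => ?_
    obtain ⟨i, hi⟩ := Nat.exists_eq_add_of_le (Nat.lt_succ_iff.1 (Finset.mem_range.1 hj))
    have hi' : p - j = i := by omega
    have hf : ((p + 1 + j).factorial : ℝ) ≠ 0 := by positivity
    rw [hi', show p + j + 1 = p + 1 + j by ring, show c + a + 1 = c + 1 + a by ring,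
      show 2 * p + 2 = (p + 1 + j + 1) + i by omega, pow_add (c + 1 + a) (p + 1 + j + 1) i]
    rw [show (-a) ^ j = (-1) ^ j * a ^ j by rw [neg_pow], pow_add a (p + 1) j]
    field_simp
  · intro j _
    -- A non-integrable function has integral `0` by convention, so a nonzero value yields
    -- integrability.
    refine Integrable.const_mul (.of_integral_ne_zero ?_) _
    rw [hval]
    positivity

/-! ### Lacunary frequencies and almost orthogonality -/

theorem IsLacunary.monotone {Λ : ℕ → ℝ≥0} (h : IsLacunary Λ) : Monotone Λ := by
  obtain ⟨-, r, hr, h⟩ := h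
  exact monotone_nat_of_le_succ fun n => (le_mul_of_one_le_left zero_le hr.le).trans (h n)

theorem IsLacunary.tendsto_atTop {Λ : ℕ → ℝ≥0} (h : IsLacunary Λ) :
    Tendsto (fun n => (Λ n : ℝ)) atTop atTop := by
  obtain ⟨hpos, r, hr, h⟩ := h
  have h' (n : ℕ) : (r : ℝ) ^ n * Λ 0 ≤ Λ n := by
    induction n with
    | zero => simp
    | succ n ih =>
      calc (r : ℝ) ^ (n + 1) * Λ 0 = r * (r ^ n * Λ 0) := by ring
        _ ≤ r * Λ n := by gcongr
        _ ≤ _ := by exact_mod_cast h n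
  exact tendsto_atTop_mono h' ((tendsto_pow_atTop_atTop_of_one_lt
    (by exact_mod_cast hr)).atTop_mul_const (by exact_mod_cast hpos 0))

theorem IsLacunary.exists_ratio_add_one {Λ : ℕ → ℝ≥0} (h : IsLacunary Λ) :
    ∃ r : ℝ, 1 < r ∧ ∀ n, r * ((Λ n : ℝ) + 1) ≤ (Λ (n + 1) : ℝ) + 1 := by
  have hm := h.monotone
  obtain ⟨hpos, r, hr, h⟩ := h
  have h0 : (0 : ℝ) < Λ 0 := by exact_mod_cast hpos 0
  have hr : (1 : ℝ) < r := by exact_mod_cast hr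
  -- `(r * x + 1) / (x + 1)` increases with `x`, so its value at `Λ 0` is the worst ratio.
  refine ⟨(r * Λ 0 + 1) / (Λ 0 + 1), by rw [one_lt_div (by positivity)]; nlinarith, fun n => ?_⟩
  have hn : (Λ 0 : ℝ) ≤ Λ n := by exact_mod_cast hm (Nat.zero_le n)
  have h1 : (r : ℝ) * Λ n ≤ Λ (n + 1) := by exact_mod_cast h n
  rw [div_mul_eq_mul_div, div_le_iff₀ (by positivity)]
  nlinarith

/-- The left side depends only on `z = y / x`, is invariant under `z ↦ 1 / z`, and decreases for `z
≥ 1`. -/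
theorem mul_div_add_sq_le {r x y : ℝ} (hr : 1 < r) (hx : 0 < x) (hy : 0 < y)
    (h : r * x ≤ y ∨ r * y ≤ x) : x * y / (x + y) ^ 2 ≤ r / (1 + r) ^ 2 := by
  rw [div_le_div_iff₀ (by positivity) (by positivity)]
  have key : 0 ≤ (y - r * x) * (r * y - x) := by
    rcases h with h | h
    · exact mul_nonneg (by linarith) (by nlinarith)
    · exact mul_nonneg_of_nonpos_of_nonpos (by nlinarith) (by linarith)
  nlinarith

theorem ratio_mul_le_of_lt {r : ℝ} (hr : 1 < r) {m : ℕ → ℝ} (hm : ∀ n, 0 < m n)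
    (h : ∀ n, r * m n ≤ m (n + 1)) {i j : ℕ} (hij : i < j) : r * m i ≤ m j := by
  have : Monotone m := monotone_nat_of_le_succ fun n => by nlinarith [h n, hm n]
  exact (h i).trans (this hij)

/-- Almost orthogonality: off the diagonal, high powers of `x y / (x + y) ^ 2` along a lacunary
sequence have a sum small compared with the diagonal value. -/
theorem exists_offDiag_sum_le {r : ℝ} (hr : 1 < r) {m : ℕ → ℝ} (hm : ∀ n, 0 < m n)
    (h : ∀ n, r * m n ≤ m (n + 1)) :
    ∃ p : ℕ, ∀ (s : Finset ℕ) (i : ℕ),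
      ∑ j ∈ s.erase i, (m i * m j / (m i + m j) ^ 2) ^ (p + 1) ≤ (1 / 4) ^ (p + 1) / 2 := by
  have hr' : 0 < r - 1 := by linarith
  set q := r / (1 + r) ^ 2 with hq
  have hq0 : 0 < q := by positivity
  have hq1 : 4 * q < 1 := by
    rw [hq, ← mul_div_assoc, div_lt_one (by positivity)]
    nlinarith [mul_pos hr' hr']
  -- One factor `q` of the power is kept as a summable bump and the other `p` are bounded; `8 = 4 *
  -- 2` matches the target `(1 / 4) ^ (p + 1) / 2`.
  have hlim : Tendsto (fun p : ℕ => (4 * q) ^ p * (8 * (r / (r - 1)))) atTop (𝓝 0) := by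
    simpa using (tendsto_pow_atTop_nhds_zero_of_lt_one (by positivity) hq1).mul_const
      (8 * (r / (r - 1)))
  obtain ⟨p, hp⟩ := (hlim.eventually (ge_mem_nhds one_pos)).exists
  refine ⟨p, fun s i => ?_⟩
  have hi := hm i
  calc ∑ j ∈ s.erase i, (m i * m j / (m i + m j) ^ 2) ^ (p + 1)
      ≤ ∑ j ∈ s.erase i, q ^ p * (m j / m i / (1 + m j / m i) ^ 2) := by
        refine Finset.sum_le_sum fun j hj => ?_
        have hj' := hm j
        have hle : m i * m j / (m i + m j) ^ 2 ≤ q := by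
          refine mul_div_add_sq_le hr hi hj' ?_
          rcases lt_or_gt_of_ne (Finset.ne_of_mem_erase hj) with hlt | hlt
          · exact .inr (ratio_mul_le_of_lt hr hm h hlt)
          · exact .inl (ratio_mul_le_of_lt hr hm h hlt)
        have e : m j / m i / (1 + m j / m i) ^ 2 = m i * m j / (m i + m j) ^ 2 := by
          field_simp
        rw [e, pow_succ]
        gcongr
    _ ≤ q ^ p * (r / (r - 1)) := by
        rw [← Finset.mul_sum]
        gcongr
        refine sum_div_one_add_sq_le hr (x := fun j => m j / m i)
          (fun j => div_pos (hm j) hi) (fun j => ?_) _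
        rw [← mul_div_assoc]
        exact div_le_div_of_nonneg_right (h j) hi.le
    _ ≤ _ := by
        rw [mul_pow] at hp
        have h4 : (1 / 4 : ℝ) ^ p * 4 ^ p = 1 := by rw [← mul_pow]; norm_num
        have h5 : (0 : ℝ) < (1 / 4) ^ p := by positivity
        have := mul_le_mul_of_nonneg_left hp h5.le
        rw [pow_succ]
        have e : (1 / 4 : ℝ) ^ p * (4 ^ p * q ^ p * (8 * (r / (r - 1)))) =
          q ^ p * (r / (r - 1)) * 8 := by
            calc _ = ((1 / 4 : ℝ) ^ p * 4 ^ p) * (q ^ p * (8 * (r / (r - 1)))) := by ring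
              _ = _ := by rw [h4]; ring
        rw [e] at this
        linarith

theorem norm_sum_ge_of_diag_dominant (s : Finset ℕ) (β ε : ℕ → ℂ) (A : ℕ → ℕ → ℝ) {d : ℝ}
    (hβ : ∀ n, ε n * β n = ‖β n‖) (hε : ∀ n, ‖ε n‖ ≤ 1) (hA : ∀ i j, 0 ≤ A i j)
    (hd : ∀ i, A i i = d) (hoff : ∀ i, ∑ j ∈ s.erase i, A i j ≤ d / 2) :
    d / 2 * ∑ i ∈ s, ‖β i‖ ≤ ‖∑ i ∈ s, ∑ j ∈ s, ε j * β i * A i j‖ := by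
  have e : ∑ i ∈ s, ∑ j ∈ s, ε j * β i * A i j =
      ((d * ∑ i ∈ s, ‖β i‖ : ℝ) : ℂ) + ∑ i ∈ s, ∑ j ∈ s.erase i, ε j * β i * A i j := by
    push_cast
    rw [Finset.mul_sum, ← Finset.sum_add_distrib]
    refine Finset.sum_congr rfl fun i hi => ?_
    rw [← Finset.add_sum_erase s _ hi, hβ, hd, mul_comm]
  have hb : ‖∑ i ∈ s, ∑ j ∈ s.erase i, ε j * β i * A i j‖ ≤ d / 2 * ∑ i ∈ s, ‖β i‖ := by
    rw [Finset.mul_sum]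
    refine norm_sum_le_of_le _ fun i _ => ?_
    calc _ ≤ ∑ j ∈ s.erase i, ‖β i‖ * A i j := norm_sum_le_of_le _ fun j _ => by
          rw [norm_mul, norm_mul, Complex.norm_real, Real.norm_of_nonneg (hA i j)]
          refine mul_le_mul_of_nonneg_right ?_ (hA i j)
          exact mul_le_of_le_one_left (norm_nonneg _) (hε j)
      _ ≤ _ := by
          rw [← Finset.mul_sum, mul_comm]
          exact mul_le_mul_of_nonneg_right (hoff i) (norm_nonneg _)
  have h1 := norm_sub_le_norm_add ((d * ∑ i ∈ s, ‖β i‖ : ℝ) : ℂ)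
    (∑ i ∈ s, ∑ j ∈ s.erase i, ε j * β i * A i j)
  have h2 : d * ∑ i ∈ s, ‖β i‖ ≤ ‖((d * ∑ i ∈ s, ‖β i‖ : ℝ) : ℂ)‖ := by
    rw [Complex.norm_real]; exact le_abs_self _
  rw [e]
  linarith

/-! ### The lower `ℓ¹` estimate -/

theorem norm_muntzPolynomialL1 (Λ : ℕ → ℝ≥0) (ν : Measure I) [IsFiniteMeasure ν] (b : ℕ →₀ ℂ) :
    ‖muntzPolynomialL1 Λ ν b‖ = ∫ t, ‖muntzPolynomial Λ b t‖ ∂ν := by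
  rw [L1.norm_eq_integral_norm]
  refine integral_congr_ae ?_
  filter_upwards [ContinuousMap.coeFn_toLp (p := 1) (𝕜 := ℂ) ν (muntzPolynomial Λ b)] with t ht
  exact congrArg norm ht

/-- Gurariy--Macaev: in `L¹([0,1])` the normalized monomials of a lacunary sequence dominate the
`ℓ¹` norm of the coefficients. -/
theorem IsLacunary.exists_sum_norm_le {Λ : ℕ → ℝ≥0} (hΛ : IsLacunary Λ) :
    ∃ K : ℝ, 0 ≤ K ∧ ∀ b : ℕ →₀ ℂ, ∑ n ∈ b.support, ‖b n‖ / ((Λ n : ℝ) + 1) ≤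
      K * ‖muntzPolynomialL1 Λ (volume : Measure I) b‖ := by
  obtain ⟨r, hr, h⟩ := hΛ.exists_ratio_add_one
  have hr' : 0 < r - 1 := by linarith
  set m : ℕ → ℝ := fun n => (Λ n : ℝ) + 1 with hm_def
  have hm : ∀ n, 0 < m n := fun n => by positivity
  obtain ⟨p, hp⟩ := exists_offDiag_sum_le hr hm h
  obtain ⟨C, hC0, hC⟩ := exists_abs_muntzKernel_le p
  set d : ℝ := (1 / 4) ^ (p + 1) with hd
  have hd0 : 0 < d := by positivity
  refine ⟨2 / d * (C * (r / (r - 1))), by positivity, fun b => ?_⟩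
  set s := b.support
  set β : ℕ → ℂ := fun n => b n / m n with hβ
  have hβn (n : ℕ) : ‖β n‖ = ‖b n‖ / m n := by
    rw [hβ, norm_div, Complex.norm_real, Real.norm_of_nonneg (hm n).le]
  set ε : ℕ → ℂ := fun n => (starRingEnd ℂ) (β n) / ‖β n‖ with hε
  have hεβ (n : ℕ) : ε n * β n = ‖β n‖ := by
    rw [hε]
    rcases eq_or_ne (β n) 0 with h0 | h0
    · simp [h0]
    · have : (‖β n‖ : ℂ) ≠ 0 := by exact_mod_cast norm_ne_zero_iff.2 h0
      field_simp
      rw [mul_comm, Complex.mul_conj']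
  have hε1 (n : ℕ) : ‖ε n‖ ≤ 1 := by
    rw [hε, norm_div, RCLike.norm_conj, Complex.norm_real, norm_norm]
    exact div_self_le_one _
  set A : ℕ → ℕ → ℝ := fun i j => (m i * m j / (m i + m j) ^ 2) ^ (p + 1) with hA
  have hdom := norm_sum_ge_of_diag_dominant s β ε A (d := d) hεβ hε1
    (fun i j => by have := hm i; have := hm j; positivity)
    (fun i => by
      have := hm i
      simp only [hA, hd]
      congr 1
      field_simp
      ring) (fun i => hp s i)
  -- The dual function: the phases `ε j` turn the diagonal of the pairing into `d * ∑ ‖β i‖`.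
  set Φ : I → ℂ := fun t => ∑ j ∈ s, ε j * muntzKernel p (m j) t with hΦ
  have hΦb (t : I) : ‖Φ t‖ ≤ C * (r / (r - 1)) := by
    have hlog : 0 ≤ -Real.log t := neg_nonneg.2 (Real.log_nonpos t.2.1 t.2.2)
    calc ‖Φ t‖ ≤ ∑ j ∈ s, C * (m j * -Real.log t / (1 + m j * -Real.log t) ^ 2) := by
          refine norm_sum_le_of_le _ fun j _ => ?_
          rw [norm_mul, Complex.norm_real]
          exact (mul_le_of_le_one_left (norm_nonneg _) (hε1 j)).trans (hC _ (hm j) t)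
      _ ≤ _ := by
          rw [← Finset.mul_sum]
          gcongr
          rcases hlog.eq_or_lt with h0 | h0
          · simp only [← h0, mul_zero, zero_div, Finset.sum_const_zero]
            positivity
          · refine sum_div_one_add_sq_le hr (x := fun j => m j * -Real.log t)
              (fun j => mul_pos (hm j) h0) (fun j => ?_) s
            rw [← mul_assoc]
            exact mul_le_mul_of_nonneg_right (h j) hlog
  have hint : ∫ t, muntzPolynomial Λ b t * Φ t = ∑ i ∈ s, ∑ j ∈ s, ε j * β i * A i j := by
    have hK (i j : ℕ) := integral_rpow_mul_muntzKernel p (hm j) (Λ i).2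
    have hKpos (i j : ℕ) : m j ^ (p + 1) * ((Λ i : ℝ) + 1) ^ p /
        ((Λ i : ℝ) + 1 + m j) ^ (2 * p + 2) ≠ 0 := by
      have := hm j
      positivity
    have e (t : I) : muntzPolynomial Λ b t * Φ t = ∑ i ∈ s, ∑ j ∈ s,
        b i * ε j * (((t : ℝ) ^ (Λ i : ℝ) * muntzKernel p (m j) t : ℝ) : ℂ) := by
      rw [muntzPolynomial_apply, Finsupp.sum, Finset.sum_mul_sum]
      refine Finset.sum_congr rfl fun i _ => Finset.sum_congr rfl fun j _ => ?_
      push_cast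
      ring
    have hi (i j : ℕ) : Integrable
        (fun t : I => b i * ε j * (((t : ℝ) ^ (Λ i : ℝ) * muntzKernel p (m j) t : ℝ) : ℂ)) := by
      refine Integrable.const_mul (Integrable.ofReal (.of_integral_ne_zero ?_)) _
      exact (hK i j).trans_ne (hKpos i j)
    simp_rw [e]
    rw [integral_finsetSum _ fun i _ => integrable_finsetSum _ fun j _ => hi i j]
    refine Finset.sum_congr rfl fun i _ => ?_
    rw [integral_finsetSum _ fun j _ => hi i j]
    refine Finset.sum_congr rfl fun j _ => ?_
    rw [integral_const_mul, integral_complex_ofReal, show ∫ t : I, (t : ℝ) ^ (Λ i : ℝ) *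
      muntzKernel p (m j) t = A i j / m i by
        refine (hK i j).trans ?_
        simp only [hA]
        have h1 := hm i
        have h2 := hm j
        change m j ^ (p + 1) * m i ^ p / (m i + m j) ^ (2 * p + 2) = _
        rw [div_pow, mul_pow, ← pow_mul]
        field_simp
        ring]
    simp only [hβ]
    push_cast
    ring
  have hfin : ‖∫ t, muntzPolynomial Λ b t * Φ t‖ ≤
      C * (r / (r - 1)) * ‖muntzPolynomialL1 Λ (volume : Measure I) b‖ := by
    rw [norm_muntzPolynomialL1, ← integral_const_mul]
    refine norm_integral_le_of_norm_le ?_ (ae_of_all _ fun t => ?_)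
    · refine Integrable.const_mul ?_ _
      exact ((muntzPolynomial Λ b).continuous.norm.integrable_of_hasCompactSupport
        (HasCompactSupport.of_compactSpace _))
    · rw [norm_mul, mul_comm]
      exact mul_le_mul_of_nonneg_right (hΦb t) (norm_nonneg _)
  rw [hint] at hfin
  have := hdom.trans hfin
  simp_rw [hβn] at this
  rw [div_mul_eq_mul_div, div_mul_eq_mul_div, le_div_iff₀ hd0]
  linarith

theorem coeFn_muntzPolynomialL1 (Λ : ℕ → ℝ≥0) (ν : Measure I) [IsFiniteMeasure ν] (b : ℕ →₀ ℂ) :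
    muntzPolynomialL1 Λ ν b =ᵐ[ν] muntzPolynomial Λ b :=
  ContinuousMap.coeFn_toLp (p := 1) (𝕜 := ℂ) ν (muntzPolynomial Λ b)

theorem muntzPolynomial_single_apply (Λ : ℕ → ℝ≥0) (n : ℕ) (c : ℂ) (t : I) :
    muntzPolynomial Λ (Finsupp.single n c) t = c * (((t : ℝ) ^ (Λ n : ℝ) : ℝ) : ℂ) := by
  rw [muntzPolynomial_apply, Finsupp.sum_single_index (by simp)]

theorem norm_muntzPolynomialL1_single (Λ : ℕ → ℝ≥0) (ν : Measure I) [IsFiniteMeasure ν] (n : ℕ)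
    (c : ℂ) : ‖muntzPolynomialL1 Λ ν (Finsupp.single n c)‖ =
      ‖c‖ * ∫ t : I, (t : ℝ) ^ (Λ n : ℝ) ∂ν := by
  rw [norm_muntzPolynomialL1, ← integral_const_mul]
  refine integral_congr_ae (ae_of_all _ fun t => ?_)
  simp only [muntzPolynomial_single_apply, norm_mul, Complex.norm_real]
  rw [Real.norm_of_nonneg (Real.rpow_nonneg t.2.1 _)]

theorem muntzPolynomialL1_eq_sum (Λ : ℕ → ℝ≥0) (ν : Measure I) [IsFiniteMeasure ν] (b : ℕ →₀ ℂ) :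
    muntzPolynomialL1 Λ ν b =
      ∑ n ∈ b.support, b n • muntzPolynomialL1 Λ ν (Finsupp.single n 1) := by
  conv_lhs => rw [← b.sum_single, Finsupp.sum, map_sum]
  refine Finset.sum_congr rfl fun n _ => ?_
  rw [← map_smul, Finsupp.smul_single_one]

theorem setIntegral_Ico_eq_integral (μ : Measure I) (hμ : μ {1} = 0) (f : I → ℝ) :
    ∫ t in Set.Ico (0 : I) 1, f t ∂μ = ∫ t, f t ∂μ := by
  have : (Set.Ico (0 : I) 1) =ᵐ[μ] Set.univ := by
    rw [ae_eq_univ]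
    refine measure_mono_null (fun t ht => ?_) hμ
    by_contra h1
    exact ht ⟨t.2.1, lt_of_le_of_ne t.2.2 h1⟩
  rw [setIntegral_congr_set this, setIntegral_univ]

/-! ### Compactness from (b₁) -/

theorem SatisfiesLittleB1.tendsto_add_one_mul {Λ : ℕ → ℝ≥0} (hΛ : IsLacunary Λ) {μ : Measure I}
    (hμ : μ {1} = 0) (h : SatisfiesLittleB1 Λ μ) :
    Tendsto (fun n => ((Λ n : ℝ) + 1) * ∫ t : I, (t : ℝ) ^ (Λ n : ℝ) ∂μ) atTop (𝓝 0) := by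
  simp_rw [SatisfiesLittleB1, setIntegral_Ico_eq_integral μ hμ] at h
  have h1 := h.add (h.div_atTop hΛ.tendsto_atTop)
  rw [add_zero] at h1
  refine h1.congr fun n => ?_
  have : (0 : ℝ) < Λ n := by exact_mod_cast hΛ.1 n
  field_simp

theorem isCarlesonMeasure_of_littleB1 {Λ : ℕ → ℝ≥0} (hΛ : IsLacunary Λ) {μ : Measure I}
    [IsFiniteMeasure μ] (hμ : μ {1} = 0) (h : SatisfiesLittleB1 Λ μ) : IsCarlesonMeasure Λ μ := by
  obtain ⟨K, hK0, hK⟩ := hΛ.exists_sum_norm_le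
  obtain ⟨S, hS⟩ := (h.tendsto_add_one_mul hΛ hμ).bddAbove_range
  have hS' (n : ℕ) := hS (Set.mem_range_self n)
  have hv (n : ℕ) : 0 ≤ ∫ t : I, (t : ℝ) ^ (Λ n : ℝ) ∂μ :=
    integral_nonneg fun t => Real.rpow_nonneg t.2.1 _
  have hS0 : 0 ≤ S := (mul_nonneg (by positivity) (hv 0)).trans (hS' 0)
  refine ⟨S * K, fun b => ?_⟩
  calc ‖muntzPolynomialL1 Λ μ b‖ ≤ ∑ n ∈ b.support, S * (‖b n‖ / ((Λ n : ℝ) + 1)) := by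
        rw [muntzPolynomialL1_eq_sum]
        refine norm_sum_le_of_le _ fun n _ => ?_
        rw [norm_smul, norm_muntzPolynomialL1_single, norm_one, one_mul, ← mul_div_assoc,
          le_div_iff₀ (by positivity)]
        have := mul_le_mul_of_nonneg_left (hS' n) (norm_nonneg (b n))
        linarith
    _ ≤ _ := by
        rw [← Finset.mul_sum, mul_assoc]
        exact mul_le_mul_of_nonneg_left (hK b) hS0

theorem isCompactOperator_of_littleB1 {Λ : ℕ → ℝ≥0} (hΛ : IsLacunary Λ) {μ : Measure I}
    [IsFiniteMeasure μ] (hμ : μ {1} = 0) (h : SatisfiesLittleB1 Λ μ)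
    (hc : IsCarlesonMeasure Λ μ) : IsCompactOperator (carlesonEmbedding Λ μ hc) := by
  obtain ⟨K, hK0, hK⟩ := hΛ.exists_sum_norm_le
  set T := carlesonEmbedding Λ μ hc
  set e : ℕ → Lp ℂ 1 μ := fun n =>
    muntzPolynomialL1 Λ μ (Finsupp.single n (((Λ n : ℝ) + 1 : ℝ) : ℂ)) with he
  have he0 : Tendsto e atTop (𝓝 0) := by
    rw [tendsto_zero_iff_norm_tendsto_zero]
    refine (h.tendsto_add_one_mul hΛ hμ).congr fun n => ?_
    rw [he, norm_muntzPolynomialL1_single, Complex.norm_real, Real.norm_of_nonneg (by positivity)]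
  set Z : Set (Lp ℂ 1 μ) :=
    (fun q : ℂ × Lp ℂ 1 μ => q.1 • q.2) '' (Metric.closedBall 0 K ×ˢ insert 0 (Set.range e))
  have hZ : IsCompact Z :=
    ((isCompact_closedBall 0 K).prod he0.isCompact_insert_range).image (by fun_prop)
  have hZ0 : (0 : Lp ℂ 1 μ) ∈ Z :=
    ⟨(0, 0), ⟨Metric.mem_closedBall_self hK0, Set.mem_insert _ _⟩, by simp⟩
  -- Mazur: in a complete space the closed convex hull of a compact set is compact.
  have hcomp : IsCompact (closure (convexHull ℝ Z)) :=
    hZ.totallyBounded.convexHull.closure.isCompact_of_isClosed isClosed_closure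
  refine (isCompactOperator_iff_image_ball_subset_compact T.toLinearMap one_pos).2
    ⟨_, hcomp, ?_⟩
  have hpoly (b : ℕ →₀ ℂ) (hb : ‖muntzPolynomialL1 Λ (volume : Measure I) b‖ < 1) :
      muntzPolynomialL1 Λ μ b ∈ convexHull ℝ Z := by
    set w : ℕ → ℝ := fun n => ‖b n‖ / ((Λ n : ℝ) + 1)
    have hw0 (n : ℕ) : 0 ≤ w n := by positivity
    set W := ∑ n ∈ b.support, w n with hW
    have hWK : W ≤ K := (hK b).trans (mul_le_of_le_one_right hK0 hb.le)
    -- The case `W = 0` is separate because the center of mass divides by `W`.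
    rcases (Finset.sum_nonneg fun n (_ : n ∈ b.support) => hw0 n).eq_or_lt with hW0 | hW0
    · have : muntzPolynomialL1 Λ μ b = 0 := by
        rw [muntzPolynomialL1_eq_sum]
        refine Finset.sum_eq_zero fun n hn => ?_
        have h0 := (Finset.sum_eq_zero_iff_of_nonneg fun n _ => hw0 n).1 hW0.symm n hn
        rcases div_eq_zero_iff.1 h0 with h0 | h0
        · rw [norm_eq_zero.1 h0, zero_smul]
        · have : (0 : ℝ) < Λ n + 1 := by positivity
          exact absurd h0 this.ne'
      rw [this]
      exact subset_convexHull ℝ Z hZ0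
    -- The weights are `w n / W`; the phase of `b n` and the total mass `W ≤ K` go into the scalar
    -- multiplying `e n`.
    · have hmem := b.support.centerMass_mem_convexHull (s := Z) (w := w)
        (z := fun n => ((W : ℂ) * (b n / ‖b n‖)) • e n) (fun n _ => hw0 n) hW0 fun n _ => by
          refine ⟨((W : ℂ) * (b n / ‖b n‖), e n), ⟨?_, .inr ⟨n, rfl⟩⟩, rfl⟩
          rw [mem_closedBall_zero_iff, norm_mul, norm_div, Complex.norm_real, Complex.norm_real,
            norm_norm, Real.norm_of_nonneg hW0.le]
          exact (mul_le_of_le_one_right hW0.le (div_self_le_one _)).trans hWK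
      convert hmem using 1
      rw [Finset.centerMass, muntzPolynomialL1_eq_sum, Finset.smul_sum]
      refine Finset.sum_congr rfl fun n hn => ?_
      have hm : ((Λ n : ℝ) : ℂ) + 1 ≠ 0 := by
        have : (Λ n : ℝ) + 1 ≠ 0 := by positivity
        exact_mod_cast this
      have hrs (a : ℝ) (x : Lp ℂ 1 μ) : a • x = (a : ℂ) • x :=
        RCLike.real_smul_eq_coe_smul (K := ℂ) a x
      have hWc : (W : ℂ) ≠ 0 := by exact_mod_cast hW0.ne'
      have hbn : (‖b n‖ : ℂ) ≠ 0 := by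
        exact_mod_cast norm_ne_zero_iff.2 (Finsupp.mem_support_iff.1 hn)
      simp only [he]
      rw [← Finsupp.smul_single_one n (((Λ n : ℝ) + 1 : ℝ) : ℂ), map_smul, hrs, hrs,
        smul_smul, smul_smul, smul_smul]
      congr 1
      simp only [← hW, w]
      push_cast
      field_simp
  rintro _ ⟨x, hx, rfl⟩
  have hx' : x ∈ closure (Metric.ball 0 1 ∩ Set.range (muntzPolynomialInSpace Λ)) :=
    (denseRange_muntzPolynomialInSpace Λ).open_subset_closure_inter Metric.isOpen_ball hx
  refine closure_mono ?_ (image_closure_subset_closure_image T.continuous ⟨x, hx', rfl⟩)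
  rintro _ ⟨_, ⟨hb, b, rfl⟩, rfl⟩
  rw [show T (muntzPolynomialInSpace Λ b) = _ from carlesonEmbedding_polynomial Λ μ hc b]
  exact hpoly b (mem_ball_zero_iff.1 hb)

/-! ### Weak compactness and the return to (b₁) -/

theorem IsCompactOperator.isWeaklyCompactOperator {E F : Type*} [NormedAddCommGroup E]
    [NormedSpace ℂ E] [NormedAddCommGroup F] [NormedSpace ℂ F] {T : E →L[ℂ] F}
    (h : IsCompactOperator T) : IsWeaklyCompactOperator T := by
  have h1 := IsCompactOperator.isCompact_closure_image_closedBall (f := T.toLinearMap) h 1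
  have h2 := h1.image (toWeakSpaceCLM ℂ F).continuous
  exact h2.of_isClosed_subset isClosed_closure
    (closure_minimal (Set.image_mono subset_closure) h2.isClosed)

/-- Integration over a set, as a continuous linear functional on `L¹`. -/
noncomputable def setIntegralCLM {X : Type*} [MeasurableSpace X] (μ : Measure X) (s : Set X) :
    Lp ℂ 1 μ →L[ℂ] ℂ where
  toFun f := ∫ x in s, f x ∂μ
  map_add' f g := by
    rw [integral_congr_ae (ae_restrict_of_ae (Lp.coeFn_add f g))]
    exact integral_add (L1.integrable_coeFn f).integrableOn (L1.integrable_coeFn g).integrableOn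
  map_smul' c f := by
    rw [integral_congr_ae (ae_restrict_of_ae (Lp.coeFn_smul c f))]
    exact integral_const_mul c _
  cont := continuous_setIntegral s

theorem MapClusterPt.eq_of_tendsto {X ι : Type*} [TopologicalSpace X] [T2Space X] {F : Filter ι}
    {u : ι → X} {x y : X} (hx : MapClusterPt x F u) (hy : Tendsto u F (𝓝 y)) : x = y := by
  have : NeBot (𝓝 x ⊓ map u F) := hx
  exact eq_of_nhds_neBot (this.mono (inf_le_inf_left _ hy))

theorem tendsto_setIntegral_muntzPolynomial_single {Λ : ℕ → ℝ≥0} (hΛ : IsLacunary Λ)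
    (μ : Measure I) [IsFiniteMeasure μ] {q : ℝ} (hq0 : 0 < q) (hq1 : q < 1) :
    Tendsto (fun n => ∫ t in {t : I | (t : ℝ) ≤ q},
      muntzPolynomial Λ (Finsupp.single n ((Λ n : ℝ) : ℂ)) t ∂μ) atTop (𝓝 0) := by
  have h1 : Tendsto (fun n => (Λ n : ℝ) * q ^ (Λ n : ℝ) * μ.real {t : I | (t : ℝ) ≤ q}) atTop
      (𝓝 0) := by
    have := (tendsto_rpow_mul_exp_neg_mul_atTop_nhds_zero 1 (-Real.log q)
      (neg_pos.2 (Real.log_neg hq0 hq1))).comp hΛ.tendsto_atTop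
    simpa [Function.comp_def, Real.rpow_def_of_pos hq0] using
      this.mul_const (μ.real {t : I | (t : ℝ) ≤ q})
  refine squeeze_zero_norm (fun n => ?_) h1
  refine norm_setIntegral_le_of_norm_le_const (measure_lt_top _ _) fun t ht => ?_
  rw [muntzPolynomial_single_apply, norm_mul, Complex.norm_real, Complex.norm_real,
    Real.norm_of_nonneg (NNReal.coe_nonneg (Λ n)), Real.norm_of_nonneg (Real.rpow_nonneg t.2.1 _)]
  exact mul_le_mul_of_nonneg_left (Real.rpow_le_rpow t.2.1 ht (Λ n).2) (Λ n).2

theorem littleB1_of_isWeaklyCompactOperator {Λ : ℕ → ℝ≥0} (hΛ : IsLacunary Λ) {μ : Measure I}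
    [IsFiniteMeasure μ] (hμ : μ {1} = 0) (hc : IsCarlesonMeasure Λ μ)
    (h : IsWeaklyCompactOperator (carlesonEmbedding Λ μ hc)) : SatisfiesLittleB1 Λ μ := by
  simp_rw [SatisfiesLittleB1, setIntegral_Ico_eq_integral μ hμ]
  set b : ℕ → ℕ →₀ ℂ := fun n => Finsupp.single n ((Λ n : ℝ) : ℂ) with hb
  set u : ℕ → ℝ := fun n => (Λ n : ℝ) * ∫ t : I, (t : ℝ) ^ (Λ n : ℝ) ∂μ with hu
  have hu0 (n : ℕ) : 0 ≤ u n :=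
    mul_nonneg (Λ n).2 (integral_nonneg fun t => Real.rpow_nonneg t.2.1 _)
  by_contra hnot
  obtain ⟨δ, hδ, hfreq⟩ : ∃ δ > 0, ∃ᶠ n in atTop, δ ≤ u n := by
    simp only [Metric.tendsto_nhds, not_forall] at hnot
    obtain ⟨δ, hδ, hn⟩ := hnot
    refine ⟨δ, hδ, (not_eventually.1 hn).mono fun n hn => ?_⟩
    rwa [Real.dist_eq, sub_zero, abs_of_nonneg (hu0 n), not_lt] at hn
  -- A cluster point along this filter suffices, so no weakly convergent subsequence is needed.
  set F := atTop ⊓ 𝓟 {n | δ ≤ u n}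
  have hF : F.NeBot := frequently_iff_neBot.1 hfreq
  have hmem (n : ℕ) : toWeakSpace ℂ (Lp ℂ 1 μ) (muntzPolynomialL1 Λ μ (b n)) ∈
      closure (toWeakSpace ℂ _ '' (carlesonEmbedding Λ μ hc '' Metric.closedBall 0 1)) := by
    refine subset_closure ⟨_, ⟨muntzPolynomialInSpace Λ (b n), ?_,
      carlesonEmbedding_polynomial Λ μ hc (b n)⟩, rfl⟩
    rw [mem_closedBall_zero_iff]
    change ‖muntzPolynomialL1 Λ (volume : Measure I) (b n)‖ ≤ 1
    have h1 := integral_neg_log_pow_mul_rpow 0 (Λ n).2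
    simp only [pow_zero, one_mul, Nat.factorial_zero, Nat.cast_one, zero_add, pow_one] at h1
    rw [norm_muntzPolynomialL1_single, Complex.norm_real, Real.norm_of_nonneg (NNReal.coe_nonneg (Λ n))]
    have h2 : (0 : ℝ) ≤ Λ n := (Λ n).2
    refine (congrArg _ h1).trans_le ?_
    rw [mul_one_div]
    exact (div_le_one (by positivity)).2 (le_add_of_nonneg_right zero_le_one)
  obtain ⟨g, -, hg⟩ := IsCompact.exists_mapClusterPt h (f := F)
    (u := fun n => toWeakSpace ℂ (Lp ℂ 1 μ) (muntzPolynomialL1 Λ μ (b n)))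
    (tendsto_principal.2 (Eventually.of_forall hmem))
  set g' : Lp ℂ 1 μ := (toWeakSpace ℂ _).symm g
  have hcl (s : Set I) : MapClusterPt (∫ t in s, g' t ∂μ) F
      (fun n => ∫ t in s, muntzPolynomial Λ (b n) t ∂μ) := by
    have hcont : Continuous fun x : WeakSpace ℂ (Lp ℂ 1 μ) =>
        setIntegralCLM μ s ((toWeakSpace ℂ _).symm x) :=
      WeakBilin.eval_continuous (topDualPairing ℂ (Lp ℂ 1 μ)).flip (setIntegralCLM μ s)
    have := hg.continuousAt_comp hcont.continuousAt
    refine this.congrFun (Eventually.of_forall fun n => ?_)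
    exact integral_congr_ae (ae_restrict_of_ae (coeFn_muntzPolynomialL1 Λ μ (b n)))
  -- The shift by `2` keeps `q 0 = 1 / 2` positive, as the decay lemma on `[0, q]` requires.
  set q : ℕ → ℝ := fun k => 1 - 1 / ((k : ℝ) + 2) with hq
  have hzero (k : ℕ) : ∫ t in {t : I | (t : ℝ) ≤ q k}, g' t ∂μ = 0 := by
    have hk : (1 : ℝ) / ((k : ℝ) + 2) < 1 := by
      rw [div_lt_one (by positivity)]; linarith [(Nat.cast_nonneg k : (0 : ℝ) ≤ k)]
    have hk' : (0 : ℝ) < 1 / ((k : ℝ) + 2) := by positivity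
    exact (hcl _).eq_of_tendsto ((tendsto_setIntegral_muntzPolynomial_single hΛ μ
      (by simp only [hq]; linarith) (by simp only [hq]; linarith)).mono_left inf_le_left)
  -- The sets exhaust `[0, 1)`; here `μ {1} = 0` prevents mass from being lost at the endpoint.
  have hunion : (⋃ k, {t : I | (t : ℝ) ≤ q k}) =ᵐ[μ] Set.univ := by
    rw [ae_eq_univ]
    refine measure_mono_null (fun t ht => ?_) hμ
    by_contra h1
    have h1 : (t : ℝ) < 1 := lt_of_le_of_ne t.2.2 fun h => h1 (Subtype.ext h)
    obtain ⟨k, hk⟩ := exists_nat_one_div_lt (sub_pos.2 h1)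
    refine ht (Set.mem_iUnion.2 ⟨k, ?_⟩)
    have : (1 : ℝ) / ((k : ℝ) + 2) ≤ 1 / ((k : ℝ) + 1) := by gcongr; norm_num
    simp only [Set.mem_ofPred_eq, hq]
    linarith
  have hmono : Monotone fun k => {t : I | (t : ℝ) ≤ q k} := by
    intro i j hij t ht
    have : (1 : ℝ) / ((j : ℝ) + 2) ≤ 1 / ((i : ℝ) + 2) := by gcongr
    simp only [Set.mem_ofPred_eq, hq] at ht ⊢
    linarith
  have hlim := tendsto_setIntegral_of_monotone (μ := μ) (f := g')
    (fun k => measurableSet_le measurable_subtype_coe measurable_const) hmono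
    (L1.integrable_coeFn g').integrableOn
  simp_rw [hzero] at hlim
  rw [setIntegral_congr_set hunion] at hlim
  have hg0 : ∫ t in Set.univ, g' t ∂μ = 0 := tendsto_nhds_unique hlim tendsto_const_nhds
  have hclu := hcl Set.univ
  rw [hg0] at hclu
  have hclosed : IsClosed {z : ℂ | δ ≤ z.re} := isClosed_le continuous_const Complex.continuous_re
  have : (0 : ℂ) ∈ {z : ℂ | δ ≤ z.re} := by
    refine hclosed.mem_of_mapClusterPt hclu ?_
    refine eventually_inf_principal.2 (Eventually.of_forall fun n hn => ?_)
    have e : ∫ t in Set.univ, muntzPolynomial Λ (b n) t ∂μ = (u n : ℂ) := by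
      rw [setIntegral_univ]
      simp only [hb, muntzPolynomial_single_apply]
      rw [integral_const_mul, integral_complex_ofReal, hu]
      push_cast
      rfl
    rw [e]
    exact hn
  simp only [Set.mem_ofPred_eq, Complex.zero_re] at this
  linarith

/-- `μ` is a finite measure on `[0,1)`, i.e. a finite measure on `[0,1]` with `μ {1} = 0`. -/
theorem mainTheorem9 (Λ : ℕ → ℝ≥0) (hΛ : IsLacunary Λ)
    (μ : Measure I) [IsFiniteMeasure μ] (hμ : μ {1} = 0) :
    List.TFAE
      [ SatisfiesLittleB1 Λ μ,
        ∃ h : IsCarlesonMeasure Λ μ, IsCompactOperator (carlesonEmbedding Λ μ h),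
        ∃ h : IsCarlesonMeasure Λ μ, IsWeaklyCompactOperator (carlesonEmbedding Λ μ h) ] := by
  tfae_have 1 → 2 := fun h => ⟨isCarlesonMeasure_of_littleB1 hΛ hμ h,
    isCompactOperator_of_littleB1 hΛ hμ h _⟩
  tfae_have 2 → 3 := fun ⟨h, hT⟩ => ⟨h, hT.isWeaklyCompactOperator⟩
  tfae_have 3 → 1 := fun ⟨h, hT⟩ => littleB1_of_isWeaklyCompactOperator hΛ hμ h hT
  tfae_finish
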